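/- All systems $A,B,\dots$ are non-zero finite-dimensional complex Hilbert spaces, $|A|$ denotes the dimension of $A$, $\log$ is the logarithm to base 2, and $\mathrm{CPTP}(A\to B)$ is the set of quantum channels (completely positive trace-preserving linear maps from operators on $A$ to operators on $B$). A state of $B$ is identified with the channel from the trivial system $\mathbb{C}$ to $B$ that prepares it. An isometry channel $\mathcal{V}\in\mathrm{CPTP}(A\to B)$ is a channel of the form $\rho\mapsto V\rho V^*$ with $V^*V=1_A$. A superchannel $\Theta$ from $\mathrm{CPTP}(A\to B)$ to $\mathrm{CPTP}(A'\to B)$ is a map of the form $\Theta[\mathcal{N}]=\mathcal{E}\circ(\mathsf{id}^R\otimes\mathcal{N})\circ\mathcal{W}$ with a system $R$, an isometry channel $\mathcal{W}\in\mathrm{CPTP}(A'\to RA)$ and a channel $\mathcal{E}\in\mathrm{CPTP}(RB\to B)$, regarded as acting on all linear maps $\mathcal{N}$ from operators on $A$ to operators on $B$; such a realization is in standard form if $|R|$ is the smallest possible among all realizations of $\Theta$. $\Theta$ is mixing if it has a realization in standard form for which $\mathcal{E}$ is conditionally unital, i.e. $\omega\mapsto\mathcal{E}(\tau\otimes\omega)$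 is a unital channel for every density matrix $\tau$ on $R$. For channels $\mathcal{N}\in\mathrm{CPTP}(A\to B)$ and $\mathcal{M}\in\mathrm{CPTP}(A'\to B)$ with the same output system, $\mathcal{N}\succ\mathcal{M}$ means that $\mathcal{M}=\Theta[\mathcal{N}]$ for some mixing superchannel $\Theta$. For $\mathcal{N}\in\mathrm{CPTP}(A\to B)$ and $\mathcal{M}\in\mathrm{CPTP}(A'\to B')$ in general, $\mathcal{N}\succ\mathcal{M}$ means that either $|B|>|B'|$ and $\mathcal{N}\succ\mathcal{U}\circ\mathcal{M}$ for some isometry channel $\mathcal{U}\in\mathrm{CPTP}(B'\to B)$, or $|B|\le|B'|$ and $\mathcal{U}\circ\mathcal{N}\succ\mathcal{M}$ for some isometry channel $\mathcal{U}\in\mathrm{CPTP}(B\to B')$. A (normalized) channel entropy is a function $\mathbb{H}:\bigcup_{A,B}\mathrm{CPTP}(A\to B)\to\mathbb{R}$, $\mathcal{N}\mapsto\mathbb{H}(B|A)_{\mathcal{N}}$, that is not identically zero and satisfies, for all channels $\mathcal{N}\in\mathrm{CPTP}(A\to B)$ and $\mathcal{M}\in\mathrm{CPTP}(A'\to B')$: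 (monotonicity) if $\mathcal{N}\succ\mathcal{M}$ then $\mathbb{H}(B|A)_{\mathcal{N}}\le\mathbb{H}(B'|A')_{\mathcal{M}}$; (additivity) $\mathbb{H}(BB'|AA')_{\mathcal{N}\otimes\mathcal{M}}=\mathbb{H}(B|A)_{\mathcal{N}}+\mathbb{H}(B'|A')_{\mathcal{M}}$; (normalization) the uniform qubit state has entropy $1$. **Theorem (inevitable negativity).** Let $\mathbb{H}$ be a channel entropy and let $\mathcal{V}\in\mathrm{CPTP}(A\to B)$ be an isometry channel. Then $$\mathbb{H}(B|A)_{\mathcal{V}}=-\log|A|.$$ In particular, every channel entropy takes a strictly negative value on some quantum channel. -/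

import Mathlib

open scoped Matrix Kronecker ComplexOrder

noncomputable section

/-- A finite-dimensional quantum system, i.e. a non-zero finite-dimensional Hilbert space with a
fixed orthonormal basis, given by the finite nonempty set labelling that basis. Operators on the
system are the complex matrices indexed by this set. -/
structure QSystem : Type 1 where
  carrier : Type
  [fintype : Fintype carrier]
  [decEq : DecidableEq carrier]
  [nonempty : Nonempty carrier]

namespace QSystem

instance : CoeSort QSystem Type := ⟨QSystem.carrier⟩

instance (A : QSystem) : Fintype A := A.fintype
instance (A : QSystem) : DecidableEq A := A.decEq
instance (A : QSystem) : Nonempty A := A.nonempty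

/-- The dimension `|A|`. -/
def dim (A : QSystem) : ℕ := Fintype.card A

/-- The composite system `AB`. -/
abbrev prod (A B : QSystem) : QSystem := ⟨A × B⟩

/-- The trivial (one-dimensional) system. -/
abbrev trivial : QSystem := ⟨Unit⟩

/-- The qubit. -/
abbrev qubit : QSystem := ⟨Fin 2⟩

end QSystem

/-- Linear maps from the operators on `A` to the operators on `B`. -/
abbrev SuperOp (A B : Type) : Type := Matrix A A ℂ →ₗ[ℂ] Matrix B B ℂ

namespace SuperOp

/-- `id_R ⊗ Φ`: apply `Φ` to every block of a matrix over `R × A`. -/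
def idTensor (R : Type) {A B : Type} (Φ : SuperOp A B) : SuperOp (R × A) (R × B) where
  toFun X := Matrix.of fun p q => Φ (Matrix.of fun a a' => X (p.1, a) (q.1, a')) p.2 q.2
  map_add' X Y := by
    ext p q
    exact congrFun (congrFun (Φ.map_add (Matrix.of fun a a' => X (p.1, a) (q.1, a'))
      (Matrix.of fun a a' => Y (p.1, a) (q.1, a'))) p.2) q.2
  map_smul' c X := by
    ext p q
    exact congrFun (congrFun (Φ.map_smul c (Matrix.of fun a a' => X (p.1, a) (q.1, a'))) p.2) q.2

/-- `Φ ⊗ id_R`. -/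
def tensorId (R : Type) {A B : Type} (Φ : SuperOp A B) : SuperOp (A × R) (B × R) where
  toFun X := Matrix.of fun p q => Φ (Matrix.of fun a a' => X (a, p.2) (a', q.2)) p.1 q.1
  map_add' X Y := by
    ext p q
    exact congrFun (congrFun (Φ.map_add (Matrix.of fun a a' => X (a, p.2) (a', q.2))
      (Matrix.of fun a a' => Y (a, p.2) (a', q.2))) p.1) q.1
  map_smul' c X := by
    ext p q
    exact congrFun (congrFun (Φ.map_smul c (Matrix.of fun a a' => X (a, p.2) (a', q.2))) p.1) q.1

/-- `Φ ⊗ Ψ = (Φ ⊗ id) ∘ (id ⊗ Ψ)`. -/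
def tensor {A B A' B' : Type} (Φ : SuperOp A B) (Ψ : SuperOp A' B') :
    SuperOp (A × A') (B × B') :=
  tensorId B' Φ ∘ₗ idTensor A Ψ

/-- Sanity check of the tensor product: on elementary tensors it acts factorwise. -/
theorem tensor_kronecker {A B A' B' : Type} (Φ : SuperOp A B) (Ψ : SuperOp A' B')
    (X : Matrix A A ℂ) (Y : Matrix A' A' ℂ) :
    tensor Φ Ψ (X ⊗ₖ Y) = Φ X ⊗ₖ Ψ Y := by
  ext ⟨b, b'⟩ ⟨c, c'⟩
  have h1 : ∀ a a' : A, (Ψ (Matrix.of fun x y => X a a' * Y x y)) b' c'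
      = X a a' * Ψ Y b' c' := fun a a' =>
    congrFun (congrFun (Ψ.map_smul (X a a') Y) b') c'
  have h2 : (Matrix.of fun a a' : A => (Ψ (Matrix.of fun x y => X a a' * Y x y)) b' c')
      = (Ψ Y b' c') • X := by
    ext a a'
    simp [h1, mul_comm]
  have h3 := congrFun (congrFun (Φ.map_smul (Ψ Y b' c') X) b) c
  change Φ (Matrix.of fun a a' : A => (Ψ (Matrix.of fun x y => X a a' * Y x y)) b' c') b c = _
  rw [h2, h3]
  simp [mul_comm]

/-- Complete positivity: `id_k ⊗ Φ` is positive for every `k`. -/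
def IsCompletelyPositive {A B : Type} (Φ : SuperOp A B) : Prop :=
  ∀ (k : ℕ) (X : Matrix (Fin k × A) (Fin k × A) ℂ),
    X.PosSemidef → (idTensor (Fin k) Φ X).PosSemidef

/-- Trace preservation. -/
def IsTracePreserving {A B : Type} [Fintype A] [Fintype B] (Φ : SuperOp A B) : Prop :=
  ∀ X : Matrix A A ℂ, (Φ X).trace = X.trace

theorem IsCompletelyPositive.ampl {A B : Type} {Φ : SuperOp A B} (h : Φ.IsCompletelyPositive)
    (R : Type) [Fintype R] {X : Matrix (R × A) (R × A) ℂ} (hX : X.PosSemidef) :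
    (idTensor R Φ X).PosSemidef := by
  let e := Fintype.equivFin R
  have h1 := h (Fintype.card R) _ (hX.submatrix (Prod.map e.symm id))
  have h2 := h1.submatrix (Prod.map e id)
  convert h2 using 1
  ext ⟨r, b⟩ ⟨s, c⟩
  simp [idTensor]

theorem IsCompletelyPositive.comp {A B C : Type} {Ψ : SuperOp B C} {Φ : SuperOp A B}
    (hΨ : Ψ.IsCompletelyPositive) (hΦ : Φ.IsCompletelyPositive) :
    SuperOp.IsCompletelyPositive (Ψ ∘ₗ Φ) :=
  fun k X hX => hΨ k _ (hΦ k X hX)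

theorem IsCompletelyPositive.idTensor {A B : Type} {Φ : SuperOp A B}
    (h : Φ.IsCompletelyPositive) (R : Type) [Fintype R] :
    (SuperOp.idTensor R Φ).IsCompletelyPositive := by
  intro k X hX
  have h1 := h.ampl (Fin k × R) (hX.submatrix (Equiv.prodAssoc (Fin k) R A))
  exact h1.submatrix (Equiv.prodAssoc (Fin k) R B).symm

theorem IsCompletelyPositive.tensorId {A B : Type} {Φ : SuperOp A B}
    (h : Φ.IsCompletelyPositive) (R : Type) [Fintype R] :
    (SuperOp.tensorId R Φ).IsCompletelyPositive := by
  intro k X hX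
  have h1 := h.ampl (Fin k × R)
    (hX.submatrix fun p : (Fin k × R) × A => (p.1.1, (p.2, p.1.2)))
  exact h1.submatrix fun p : Fin k × (B × R) => ((p.1, p.2.2), p.2.1)

theorem IsTracePreserving.idTensor {A B : Type} [Fintype A] [Fintype B] {Φ : SuperOp A B}
    (h : Φ.IsTracePreserving) (R : Type) [Fintype R] :
    (SuperOp.idTensor R Φ).IsTracePreserving := by
  intro X
  simp only [Matrix.trace, Fintype.sum_prod_type]
  exact Finset.sum_congr rfl fun r _ => h (Matrix.of fun a a' => X (r, a) (r, a'))

theorem IsTracePreserving.tensorId {A B : Type} [Fintype A] [Fintype B] {Φ : SuperOp A B}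
    (h : Φ.IsTracePreserving) (R : Type) [Fintype R] :
    (SuperOp.tensorId R Φ).IsTracePreserving := by
  intro X
  simp only [Matrix.trace, Fintype.sum_prod_type_right]
  exact Finset.sum_congr rfl fun r _ => h (Matrix.of fun a a' => X (a, r) (a', r))

end SuperOp

/-- Quantum channels, `CPTP(A → B)`. -/
structure Channel (A B : QSystem) where
  toMap : SuperOp A B
  completelyPositive : toMap.IsCompletelyPositive
  tracePreserving : toMap.IsTracePreserving

namespace Channel

/-- Composition `N ∘ M`. -/
def comp {A B C : QSystem} (N : Channel B C) (M : Channel A B) : Channel A C where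
  toMap := N.toMap ∘ₗ M.toMap
  completelyPositive := N.completelyPositive.comp M.completelyPositive
  tracePreserving X := (N.tracePreserving _).trans (M.tracePreserving X)

/-- The tensor product `N ⊗ M ∈ CPTP(AA' → BB')`. -/
def tensor {A B A' B' : QSystem} (N : Channel A B) (M : Channel A' B') :
    Channel (A.prod A') (B.prod B') where
  toMap := SuperOp.tensor N.toMap M.toMap
  completelyPositive :=
    (N.completelyPositive.tensorId B').comp (M.completelyPositive.idTensor A)
  tracePreserving X :=
    (N.tracePreserving.tensorId B' _).trans (M.tracePreserving.idTensor A X)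

/-- Isometry channels: `ρ ↦ V ρ V*` with `V* V = 1`. -/
def IsIsometry {A B : QSystem} (N : Channel A B) : Prop :=
  ∃ V : Matrix B A ℂ, Vᴴ * V = 1 ∧ ∀ X, N.toMap X = V * X * Vᴴ

end Channel

/-- Density matrices. -/
def IsDensity {A : QSystem} (ρ : Matrix A A ℂ) : Prop := ρ.PosSemidef ∧ ρ.trace = 1

/-- The maximally mixed state `1 / |B|`. -/
def uniformMatrix (B : QSystem) : Matrix B B ℂ := ((B.dim : ℂ)⁻¹) • (1 : Matrix B B ℂ)

theorem isDensity_uniformMatrix (B : QSystem) : IsDensity (uniformMatrix B) := by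
  constructor
  · exact Matrix.PosSemidef.one.smul (inv_nonneg.mpr (Nat.cast_nonneg _))
  · have : (Fintype.card B : ℂ) ≠ 0 := Nat.cast_ne_zero.mpr Fintype.card_ne_zero
    simp [uniformMatrix, QSystem.dim, this]

/-- A state of `B`, regarded as the channel with trivial input that prepares it. -/
def stateChannel {B : QSystem} (ρ : Matrix B B ℂ) (hρ : IsDensity ρ) :
    Channel QSystem.trivial B where
  toMap :=
    { toFun := fun X => X () () • ρ
      map_add' := fun X Y => by simp [add_smul]
      map_smul' := fun c X => by simp [mul_smul] }
  completelyPositive := fun k X hX =>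
    (hX.submatrix fun i : Fin k => (i, ())).kronecker hρ.1
  tracePreserving := fun X => by
    change (X () () • ρ).trace = X.trace
    rw [Matrix.trace_smul, hρ.2]
    simp [Matrix.trace]

/-- The uniform state `u^B`. -/
def uniformState (B : QSystem) : Channel QSystem.trivial B :=
  stateChannel (uniformMatrix B) (isDensity_uniformMatrix B)

/-- A realization of a superchannel transforming channels `A → B` into channels `A' → B`: a memory
system `R`, a pre-processing isometry channel `A' → RA` and a post-processing channel `RB → B`. -/
structure Realization (A B A' : QSystem) where
  R : QSystem
  pre : Channel A' (R.prod A)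
  pre_isometry : pre.IsIsometry
  post : Channel (R.prod B) B

namespace Realization

/-- The superchannel `N ↦ post ∘ (id_R ⊗ N) ∘ pre` that is realized. As usual it is regarded as a
map on all linear maps from operators on `A` to operators on `B`, not only on the channels. -/
def supermap {A B A' : QSystem} (r : Realization A B A') : SuperOp A B → SuperOp A' B :=
  fun Φ => r.post.toMap ∘ₗ SuperOp.idTensor r.R Φ ∘ₗ r.pre.toMap

/-- A realization is in standard form if its memory system has the least possible dimension among
all realizations of the same superchannel. -/
def IsStandardForm {A B A' : QSystem} (r : Realization A B A') : Prop :=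
  ∀ r' : Realization A B A', r'.supermap = r.supermap → r.R.dim ≤ r'.R.dim

end Realization

/-- `E ∈ CPTP(RB → B)` is conditionally unital if for every density matrix `τ` on `R` the channel
`ω ↦ E (τ ⊗ ω)` is doubly stochastic, i.e. unital. -/
def IsConditionallyUnital {R B : QSystem} (E : Channel (R.prod B) B) : Prop :=
  ∀ τ : Matrix R R ℂ, IsDensity τ → E.toMap (τ ⊗ₖ (1 : Matrix B B ℂ)) = 1

/-- A mixing superchannel: in standard form its post-processing is conditionally unital. -/
def IsMixing {A B A' : QSystem} (Θ : SuperOp A B → SuperOp A' B) : Prop :=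
  ∃ r : Realization A B A', r.supermap = Θ ∧ r.IsStandardForm ∧ IsConditionallyUnital r.post

/-- Channel majorization `N ≻ M` for channels with the same output system. -/
def MajorizesSame {A A' B : QSystem} (N : Channel A B) (M : Channel A' B) : Prop :=
  ∃ Θ : SuperOp A B → SuperOp A' B, IsMixing Θ ∧ M.toMap = Θ N.toMap

/-- Channel majorization `N ≻ M` for channels with arbitrary output systems. -/
def Majorizes {A B A' B' : QSystem} (N : Channel A B) (M : Channel A' B') : Prop :=
  (B'.dim < B.dim ∧ ∃ U : Channel B' B, U.IsIsometry ∧ MajorizesSame N (U.comp M)) ∨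
  (B.dim ≤ B'.dim ∧ ∃ V : Channel B B', V.IsIsometry ∧ MajorizesSame (V.comp N) M)

/-- A (normalized) channel entropy: a function on all quantum channels between finite-dimensional
systems that is not identically zero, monotone under channel majorization, additive under tensor
products, and takes the value `1` on the uniform qubit state. -/
structure IsChannelEntropy (H : (A B : QSystem) → Channel A B → ℝ) : Prop where
  nonzero : ∃ (A B : QSystem) (N : Channel A B), H A B N ≠ 0
  monotone : ∀ (A B A' B' : QSystem) (N : Channel A B) (M : Channel A' B'),
    Majorizes N M → H A B N ≤ H A' B' M
  additive : ∀ (A B A' B' : QSystem) (N : Channel A B) (M : Channel A' B'),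
    H (A.prod A') (B.prod B') (N.tensor M) = H A B N + H A' B' M
  normalized : H QSystem.trivial QSystem.qubit (uniformState QSystem.qubit) = 1

end

open scoped Matrix Kronecker ComplexOrder

noncomputable section

namespace SuperOp

/-- Conjugation `X ↦ K X K*`. -/
def conj {A B : Type} [Fintype A] (K : Matrix B A ℂ) : SuperOp A B where
  toFun X := K * X * Kᴴ
  map_add' X Y := by rw [Matrix.mul_add, Matrix.add_mul]
  map_smul' c X := by simp

theorem conj_apply {A B : Type} [Fintype A] (K : Matrix B A ℂ) (X : Matrix A A ℂ) :
    conj K X = K * X * Kᴴ := rfl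

theorem conj_completelyPositive {A B : Type} [Fintype A] [Finite B] (K : Matrix B A ℂ) :
    (conj K).IsCompletelyPositive := by
  intro k X hX
  have h := hX.mul_mul_conjTranspose_same ((1 : Matrix (Fin k) (Fin k) ℂ) ⊗ₖ K)
  convert h using 1
  ext ⟨i, b⟩ ⟨j, c⟩
  simp [idTensor, conj, Matrix.mul_apply, Fintype.sum_prod_type, Matrix.one_apply,
    apply_ite]

theorem sum_completelyPositive {A B ι : Type} (s : Finset ι) (Φ : ι → SuperOp A B)
    (h : ∀ i, (Φ i).IsCompletelyPositive) : (∑ i ∈ s, Φ i).IsCompletelyPositive := by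
  intro k X hX
  have : idTensor (Fin k) (∑ i ∈ s, Φ i) X = ∑ i ∈ s, idTensor (Fin k) (Φ i) X := by
    ext p q
    simp [idTensor, Matrix.sum_apply]
  rw [this]
  exact Matrix.posSemidef_sum s fun i _ => h i k X hX

end SuperOp

namespace Channel

@[ext] theorem ext {A B : QSystem} {N M : Channel A B} (h : N.toMap = M.toMap) : N = M := by
  cases N; cases M; cases h; rfl

/-- The channel `X ↦ ∑ i, K i X (K i)*`. -/
def ofKraus {A B : QSystem} {ι : Type} [Fintype ι] (K : ι → Matrix B A ℂ)
    (hK : ∑ i, (K i)ᴴ * K i = 1) : Channel A B where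
  toMap := ∑ i, SuperOp.conj (K i)
  completelyPositive :=
    SuperOp.sum_completelyPositive _ _ fun i => SuperOp.conj_completelyPositive (K i)
  tracePreserving X := by
    have h : ∀ i, (K i * X * (K i)ᴴ).trace = ((K i)ᴴ * K i * X).trace := fun i => by
      rw [Matrix.trace_mul_comm, ← Matrix.mul_assoc]
    simp only [LinearMap.sum_apply, SuperOp.conj_apply, Matrix.trace_sum, h]
    rw [← Matrix.trace_sum, ← Finset.sum_mul, hK, Matrix.one_mul]

theorem ofKraus_toMap_apply {A B : QSystem} {ι : Type} [Fintype ι] (K : ι → Matrix B A ℂ)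
    (hK : ∑ i, (K i)ᴴ * K i = 1) (X : Matrix A A ℂ) :
    (ofKraus K hK).toMap X = ∑ i, K i * X * (K i)ᴴ := by
  simp [ofKraus, SuperOp.conj_apply]

/-- The isometry channel `X ↦ V X V*`. -/
def ofIsometry {A B : QSystem} (V : Matrix B A ℂ) (hV : Vᴴ * V = 1) : Channel A B :=
  ofKraus (fun _ : Unit => V) (by simpa using hV)

theorem ofIsometry_toMap_apply {A B : QSystem} (V : Matrix B A ℂ) (hV : Vᴴ * V = 1)
    (X : Matrix A A ℂ) : (ofIsometry V hV).toMap X = V * X * Vᴴ := by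
  simp [ofIsometry, ofKraus_toMap_apply]

theorem isIsometry_ofIsometry {A B : QSystem} (V : Matrix B A ℂ) (hV : Vᴴ * V = 1) :
    (ofIsometry V hV).IsIsometry :=
  ⟨V, hV, ofIsometry_toMap_apply V hV⟩

/-- The identity channel. -/
def id (A : QSystem) : Channel A A where
  toMap := LinearMap.id
  completelyPositive _ _ hX := hX
  tracePreserving _ := rfl

theorem isIsometry_id (A : QSystem) : (id A).IsIsometry := ⟨1, by simp, fun X => by simp [id]⟩

theorem id_tensor_id (A B : QSystem) : (id A).tensor (id B) = id (A.prod B) := rfl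

theorem IsIsometry.dim_le {A B : QSystem} {N : Channel A B} (h : N.IsIsometry) :
    A.dim ≤ B.dim := by
  obtain ⟨V, hV, -⟩ := h
  calc A.dim = (Vᴴ * V).rank := by rw [hV, Matrix.rank_one, QSystem.dim]
    _ ≤ V.rank := Matrix.rank_mul_le_right _ _
    _ ≤ B.dim := Matrix.rank_le_card_height _

/-- Discarding the trivial system, `CB → B`. -/
def discardTrivial (B : QSystem) : Channel (QSystem.trivial.prod B) B where
  toMap :=
    { toFun := fun X => X.submatrix (fun b => ((), b)) (fun b => ((), b))
      map_add' := fun _ _ => rfl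
      map_smul' := fun _ _ => rfl }
  completelyPositive k X hX := hX.submatrix fun p : Fin k × B => (p.1, ((), p.2))
  tracePreserving X := by
    change ∑ b, X ((), b) ((), b) = ∑ p, X p p
    simp [Fintype.sum_prod_type]

theorem isConditionallyUnital_discardTrivial (B : QSystem) :
    IsConditionallyUnital (discardTrivial B) := by
  intro τ hτ
  have h : τ () () = 1 := by simpa [Matrix.trace] using hτ.2
  ext b c
  change τ () () * (1 : Matrix B B ℂ) b c = _
  rw [h, one_mul]

end Channel

/-- Majorization by pre-composition with an isometry. -/
theorem MajorizesSame.of_comp {A A' B : QSystem} (N : Channel A B) (W : Channel A' A)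
    (hW : W.IsIsometry) : MajorizesSame N (N.comp W) := by
  obtain ⟨V, hV, hVW⟩ := hW
  let V' : Matrix (QSystem.trivial.prod A) A' ℂ := V.submatrix Prod.snd _root_.id
  have hV' : V'ᴴ * V' = 1 := by
    rw [← hV]
    ext a b
    simp [V', Matrix.mul_apply, Fintype.sum_prod_type]
  let r : Realization A B A' :=
    { R := QSystem.trivial
      pre := Channel.ofIsometry V' hV'
      pre_isometry := Channel.isIsometry_ofIsometry _ _
      post := Channel.discardTrivial B }
  refine ⟨r.supermap, ⟨r, rfl, fun r' _ => ?_, Channel.isConditionallyUnital_discardTrivial B⟩, ?_⟩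
  · exact Fintype.card_pos
  · ext1 X
    change N.toMap (W.toMap X) = Matrix.of fun b c => N.toMap (Matrix.of fun a a' =>
      (Channel.ofIsometry V' hV').toMap X ((), a) ((), a')) b c
    rw [hVW, Channel.ofIsometry_toMap_apply]
    rfl

theorem MajorizesSame.refl {A B : QSystem} (N : Channel A B) : MajorizesSame N N :=
  MajorizesSame.of_comp N (Channel.id A) (Channel.isIsometry_id A)

theorem MajorizesSame.majorizes {A A' B : QSystem} {N : Channel A B} {M : Channel A' B}
    (h : MajorizesSame N M) : Majorizes N M :=
  Or.inr ⟨le_rfl, Channel.id B, Channel.isIsometry_id B, h⟩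

theorem Channel.IsIsometry.majorizes_id {A B : QSystem} {V : Channel A B} (hV : V.IsIsometry) :
    Majorizes V (Channel.id A) := by
  by_cases hd : A.dim < B.dim
  · exact Or.inl ⟨hd, V, hV, MajorizesSame.refl V⟩
  · have hle := not_lt.mp hd
    have heq : A.dim = B.dim := le_antisymm hV.dim_le hle
    obtain ⟨K, hK, hKV⟩ := hV
    have hK' : (Kᴴ)ᴴ * Kᴴ = 1 := by
      rw [Matrix.conjTranspose_conjTranspose]
      exact (Matrix.mul_eq_one_comm_of_card_eq A B ℂ heq).mp hK
    refine Or.inr ⟨hle, Channel.ofIsometry Kᴴ hK', Channel.isIsometry_ofIsometry _ _, ?_⟩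
    have : (Channel.ofIsometry Kᴴ hK').comp V = Channel.id A := by
      ext1
      ext1 X
      change (Channel.ofIsometry Kᴴ hK').toMap (V.toMap X) = X
      rw [Channel.ofIsometry_toMap_apply, hKV, Matrix.conjTranspose_conjTranspose]
      calc Kᴴ * (K * X * Kᴴ) * K = (Kᴴ * K) * X * (Kᴴ * K) := by simp only [Matrix.mul_assoc]
        _ = X := by rw [hK, Matrix.one_mul, Matrix.mul_one]
    rw [this]
    exact MajorizesSame.refl _

theorem Channel.IsIsometry.id_majorizes {A B : QSystem} {V : Channel A B} (hV : V.IsIsometry) :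
    Majorizes (Channel.id A) V :=
  Or.inr ⟨hV.dim_le, V, hV, MajorizesSame.refl V⟩

theorem exists_isIsometry {A B : QSystem} (h : A.dim ≤ B.dim) :
    ∃ V : Channel A B, V.IsIsometry := by
  obtain ⟨f⟩ := Function.Embedding.nonempty_of_card_le (α := A) (β := B) h
  have hV : ((1 : Matrix B B ℂ).submatrix _root_.id f)ᴴ *
      (1 : Matrix B B ℂ).submatrix _root_.id f = 1 := by
    ext a b
    simp [Matrix.mul_apply, Matrix.one_apply, f.injective.eq_iff, apply_ite, eq_comm]
  exact ⟨Channel.ofIsometry _ hV, Channel.isIsometry_ofIsometry _ hV⟩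

/-- A monotone additive function on the positive integers with `f 2 = 1` is the logarithm to
base two. -/
theorem eq_logb_of_monotone_of_additive {f : ℕ → ℝ}
    (hmono : ∀ m n, 0 < m → m ≤ n → f m ≤ f n)
    (hmul : ∀ m n, 0 < m → 0 < n → f (m * n) = f m + f n) (h2 : f 2 = 1)
    {n : ℕ} (hn : 0 < n) : f n = Real.logb 2 n := by
  have h1 : f 1 = 0 := by simpa using hmul 1 1 one_pos one_pos
  have hpow : ∀ m, 0 < m → ∀ k : ℕ, f (m ^ k) = k * f m := by
    intro m hm k
    induction k with
    | zero => simpa using h1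
    | succ k ih => rw [pow_succ, hmul _ _ (pow_pos hm k) hm, ih]; push_cast; ring
  have key : ∀ k : ℕ, k * |f n - Real.logb 2 n| ≤ 1 := by
    intro k
    have hnk : 0 < n ^ k := pow_pos hn k
    have hlo : 2 ^ Nat.log 2 (n ^ k) ≤ n ^ k := Nat.pow_log_le_self 2 hnk.ne'
    have hhi : n ^ k ≤ 2 ^ (Nat.log 2 (n ^ k) + 1) :=
      (Nat.lt_pow_succ_log_self one_lt_two _).le
    set p := Nat.log 2 (n ^ k)
    have a1 := hmono _ _ (by positivity) hlo
    have a2 := hmono _ _ hnk hhi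
    have b1 : Real.logb 2 ((2 : ℝ) ^ p) ≤ Real.logb 2 ((n : ℝ) ^ k) :=
      Real.logb_le_logb_of_le one_lt_two (by positivity) (by exact_mod_cast hlo)
    have b2 : Real.logb 2 ((n : ℝ) ^ k) ≤ Real.logb 2 ((2 : ℝ) ^ (p + 1)) :=
      Real.logb_le_logb_of_le one_lt_two (by positivity) (by exact_mod_cast hhi)
    rw [hpow _ two_pos, hpow _ hn, h2] at a1 a2
    simp only [Real.logb_pow, Real.logb_self_eq_one one_lt_two] at b1 b2
    rw [← Nat.abs_cast k, ← abs_mul, abs_le]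
    push_cast at *
    constructor <;> linarith
  by_contra hne
  have hpos : 0 < |f n - Real.logb 2 n| := abs_pos.mpr (sub_ne_zero.mpr hne)
  obtain ⟨k, hk⟩ := exists_nat_gt (1 / |f n - Real.logb 2 n|)
  have := key k
  rw [div_lt_iff₀ hpos] at hk
  linarith

/-- The entries of the Pauli matrices `X ^ j.1 * Z ^ j.2`. -/
def pauli (j : Fin 2 × Fin 2) : Matrix (Fin 2) (Fin 2) ℂ :=
  Matrix.of fun r c => if r = c + j.1 then (-1) ^ (j.2 * c : Fin 2).val else 0

theorem star_pauli (j : Fin 2 × Fin 2) (r c : Fin 2) : star (pauli j r c) = pauli j r c := by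
  by_cases h : r = c + j.1 <;> simp [pauli, h]

theorem sum_pauli_mul_pauli (r c r' c' : Fin 2) :
    ∑ j, pauli j r c * pauli j r' c' = if r = r' ∧ c = c' then 2 else 0 := by
  fin_cases r <;> fin_cases c <;> fin_cases r' <;> fin_cases c' <;>
    norm_num [pauli, show (1 + 1 : Fin 2) = 0 from rfl, Fintype.sum_prod_type]

theorem sum_pauli_mul_pauli_left (j : Fin 2 × Fin 2) (c c' : Fin 2) :
    ∑ r, pauli j r c * pauli j r c' = if c = c' then 1 else 0 := by
  obtain ⟨a, b⟩ := j
  fin_cases a <;> fin_cases b <;> fin_cases c <;> fin_cases c' <;>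
    norm_num [pauli, show (1 + 1 : Fin 2) = 0 from rfl]

theorem sum_pauli_mul_pauli_right (j : Fin 2 × Fin 2) (r r' : Fin 2) :
    ∑ c, pauli j r c * pauli j r' c = if r = r' then 1 else 0 := by
  obtain ⟨a, b⟩ := j
  fin_cases a <;> fin_cases b <;> fin_cases r <;> fin_cases r' <;>
    norm_num [pauli, show (1 + 1 : Fin 2) = 0 from rfl]

/-- The amplitude `1 / √2`. -/
def invSqrtTwo : ℂ := ((√2)⁻¹ : ℝ)

theorem star_invSqrtTwo : star invSqrtTwo = invSqrtTwo := Complex.conj_ofReal _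

theorem invSqrtTwo_mul_self : invSqrtTwo * invSqrtTwo = 1 / 2 := by
  rw [invSqrtTwo, ← Complex.ofReal_mul, ← mul_inv, Real.mul_self_sqrt zero_le_two]
  norm_num

/-- Kraus operators of `bellMeasure`. -/
def bellKraus (i : (Fin 2 × Fin 2) × Fin 2) :
    Matrix (Fin 2 × Fin 2) (Fin 2 × Fin 2 × Fin 2) ℂ :=
  Matrix.of fun q x =>
    if q = i.1 then (if x.2.2 = i.2 then invSqrtTwo * pauli i.1 x.1 x.2.1 else 0) else 0

theorem sum_bellKraus : ∑ i, (bellKraus i)ᴴ * bellKraus i = 1 := by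
  ext ⟨r, a, b⟩ ⟨r', a', b'⟩
  have h : ∀ p : Fin 2 × Fin 2, invSqrtTwo * pauli p r a * (invSqrtTwo * pauli p r' a') =
      1 / 2 * (pauli p r a * pauli p r' a') := fun p => by
    rw [← invSqrtTwo_mul_self]; ring
  rw [Matrix.sum_apply, Fintype.sum_prod_type]
  simp only [bellKraus, Matrix.mul_apply, Matrix.conjTranspose_apply, Matrix.of_apply,
    apply_ite star, star_zero, star_mul', star_invSqrtTwo, star_pauli, ite_mul, mul_ite, zero_mul,
    mul_zero, Finset.sum_ite_eq, Finset.sum_ite_eq', Finset.mem_univ, if_true, h]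
  split_ifs with hb
  · rw [← Finset.mul_sum, sum_pauli_mul_pauli]
    subst hb
    by_cases h1 : r = r' <;> by_cases h2 : a = a' <;> simp [h1, h2, Matrix.one_apply]
  · rw [Matrix.one_apply_ne]
    · simp
    · grind

/-- The Bell measurement of two qubits, discarding a third, with the outcome recorded in a pair
of qubits. -/
def bellMeasure : Channel (QSystem.qubit.prod (QSystem.qubit.prod QSystem.qubit))
    (QSystem.qubit.prod QSystem.qubit) :=
  Channel.ofKraus bellKraus sum_bellKraus

theorem bellMeasure_apply (X : Matrix (Fin 2 × Fin 2 × Fin 2) (Fin 2 × Fin 2 × Fin 2) ℂ)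
    (p q : Fin 2 × Fin 2) :
    bellMeasure.toMap X p q = if p = q then 1 / 2 * ∑ b, ∑ r, ∑ r', ∑ a, ∑ a',
      pauli p r a * pauli p r' a' * X (r, a, b) (r', a', b) else 0 := by
  have h : ∀ (p : Fin 2 × Fin 2) r a r' a' (x : ℂ),
      invSqrtTwo * pauli p r a * x * (invSqrtTwo * pauli p r' a') =
      1 / 2 * (pauli p r a * pauli p r' a' * x) := fun p r a r' a' x => by
    rw [← invSqrtTwo_mul_self]; ring
  rw [bellMeasure, Channel.ofKraus_toMap_apply, Matrix.sum_apply, Fintype.sum_prod_type]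
  by_cases hpq : p = q
  · subst hpq
    simp only [if_true, Finset.mul_sum]
    rw [Finset.sum_eq_single p]
    · refine Finset.sum_congr rfl fun b _ => ?_
      simp only [bellKraus, Matrix.mul_apply, Matrix.conjTranspose_apply, Matrix.of_apply,
        apply_ite star, star_zero, star_mul', star_invSqrtTwo, star_pauli, ite_mul, mul_ite,
        zero_mul, mul_zero, Fintype.sum_prod_type, Finset.sum_ite_eq', Finset.mem_univ, if_true,
        Finset.sum_mul, h]
      simp only [Fin.sum_univ_two]
      ring
    · intro j _ hj
      simp [bellKraus, Matrix.mul_apply, Ne.symm hj]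
    · simp
  · rw [if_neg hpq]
    refine Finset.sum_eq_zero fun j _ => Finset.sum_eq_zero fun b _ => ?_
    by_cases hj : p = j
    · have : q ≠ j := fun h => hpq (hj.trans h.symm)
      simp [bellKraus, Matrix.mul_apply, this]
    · simp [bellKraus, Matrix.mul_apply, hj]

theorem bellMeasure_kronecker_one (τ : Matrix (Fin 2) (Fin 2) ℂ) :
    bellMeasure.toMap (τ ⊗ₖ (1 : Matrix (Fin 2 × Fin 2) (Fin 2 × Fin 2) ℂ)) = τ.trace • 1 := by
  ext p q
  have h (r r' : Fin 2) : ∑ a, ∑ a', pauli p r a * pauli p r' a' *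
      (τ r r' * (1 : Matrix (Fin 2) (Fin 2) ℂ) a a') = if r = r' then τ r r' else 0 := by
    simp only [Matrix.one_apply, mul_ite, mul_one, mul_zero, Finset.sum_ite_eq, Finset.mem_univ,
      if_true]
    rw [← Finset.sum_mul, sum_pauli_mul_pauli_right]
    simp
  have h1 (a a' b : Fin 2) : (1 : Matrix (Fin 2 × Fin 2) (Fin 2 × Fin 2) ℂ) (a, b) (a', b) =
      (1 : Matrix (Fin 2) (Fin 2) ℂ) a a' := by simp [Matrix.one_apply]
  rw [bellMeasure_apply, Matrix.smul_apply, Matrix.one_apply]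
  simp only [Matrix.kroneckerMap_apply, h1, h, Finset.sum_ite_eq, Finset.mem_univ, if_true]
  split_ifs <;> simp [Matrix.trace, ← mul_add]

theorem isConditionallyUnital_bellMeasure : IsConditionallyUnital bellMeasure := fun τ hτ => by
  have h := bellMeasure_kronecker_one τ
  have h1 : Matrix.trace (n := Fin 2) τ = 1 := hτ.2
  rw [h1, one_smul] at h
  convert h using 1

/-- The two-qubit maximally entangled vector. -/
def bellVector : Matrix (Fin 2 × Fin 2 × Unit) Unit ℂ :=
  Matrix.of fun x _ => if x.1 = x.2.1 then invSqrtTwo else 0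

theorem bellVector_isometry : bellVectorᴴ * bellVector = 1 := by
  ext
  simp [bellVector, Matrix.mul_apply, Fintype.sum_prod_type, apply_ite star, star_invSqrtTwo,
    invSqrtTwo_mul_self, -RCLike.star_def]

/-- The preparation of a maximally entangled pair of qubits. -/
def bellPreparation : Channel QSystem.trivial
    (QSystem.qubit.prod (QSystem.qubit.prod QSystem.trivial)) :=
  Channel.ofIsometry bellVector bellVector_isometry

theorem bellPreparation_apply (X : Matrix Unit Unit ℂ) (x y : Fin 2 × Fin 2 × Unit) :
    bellPreparation.toMap X x y =
      if x.1 = x.2.1 then if y.1 = y.2.1 then 1 / 2 * X () () else 0 else 0 := by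
  rw [← invSqrtTwo_mul_self, bellPreparation, Channel.ofIsometry_toMap_apply]
  split_ifs with h1 h2 <;>
    simp [bellVector, Matrix.mul_apply, *, star_invSqrtTwo, -RCLike.star_def]
  ring

theorem isIsometry_bellPreparation : bellPreparation.IsIsometry :=
  Channel.isIsometry_ofIsometry _ _

theorem bellPreparation_toMap (X : Matrix QSystem.trivial QSystem.trivial ℂ) :
    bellPreparation.toMap X = bellVector * X * bellVectorᴴ :=
  Channel.ofIsometry_toMap_apply _ _ X

/-- The realization preparing a maximally entangled pair, sending one half through the channel and
measuring the result. -/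
def bellRealization : Realization (QSystem.qubit.prod QSystem.trivial)
    (QSystem.qubit.prod QSystem.qubit) QSystem.trivial where
  R := QSystem.qubit
  pre := bellPreparation
  pre_isometry := isIsometry_bellPreparation
  post := bellMeasure

/-- The linear map reading off a matrix entry and preparing a state. -/
def entryMap {A B : Type} (a a' : A) (σ : Matrix B B ℂ) : SuperOp A B where
  toFun X := X a a' • σ
  map_add' X Y := by simp [add_smul]
  map_smul' c X := by simp [mul_smul]

theorem Realization.trace_supermap_entryMap {A B A' : QSystem} (r : Realization A B A') (a a' : A)
    {σ : Matrix B B ℂ} (hσ : σ.trace = 1) (X : Matrix A' A' ℂ) :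
    (r.supermap (entryMap a a' σ) X).trace = ∑ i, r.pre.toMap X (i, a) (i, a') := by
  have h := r.post.tracePreserving (SuperOp.idTensor r.R (entryMap a a' σ) (r.pre.toMap X))
  refine h.trans ?_
  have hσ_sum : ∑ b, σ b b = 1 := hσ
  change ∑ p : r.R × B, r.pre.toMap X (p.1, a) (p.1, a') * σ p.2 p.2 = _
  simp [Fintype.sum_prod_type, ← Finset.mul_sum, hσ_sum]

/-- The memory of a realization acting on a trivial input is at least as large as the rank of the
state that is sent through the channel. -/
theorem Realization.isStandardForm_of_reduced {A B : QSystem} (r : Realization A B QSystem.trivial)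
    {W : Matrix (r.R.prod A) QSystem.trivial ℂ} (hW : ∀ X, r.pre.toMap X = W * X * Wᴴ)
    {c : ℂ} (hc : c ≠ 0)
    (hr : ∀ a a', ∑ i, W (i, a) () * star (W (i, a') ()) = if a = a' then c else 0)
    (hR : r.R.dim ≤ A.dim) : r.IsStandardForm := by
  intro r' hr'
  refine hR.trans ?_
  have hσ := (isDensity_uniformMatrix B).2
  have h : ∀ a a', ∑ i, r'.pre.toMap 1 (i, a) (i, a') = if a = a' then c else 0 := fun a a' => by
    rw [← r'.trace_supermap_entryMap a a' hσ, hr', r.trace_supermap_entryMap a a' hσ, ← hr, hW]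
    simp [Matrix.mul_apply]
  obtain ⟨V, -, hV⟩ := r'.pre_isometry
  let M : Matrix r'.R A ℂ := Matrix.of fun i a => V (i, a) ()
  have hM : Mᵀ * (c⁻¹ • Mᵀᴴ) = 1 := by
    ext a a'
    have := h a a'
    rw [hV] at this
    simp only [Matrix.mul_one] at this
    rw [Matrix.mul_smul, Matrix.smul_apply, Matrix.one_apply]
    have h2 : (Mᵀ * Mᵀᴴ) a a' = if a = a' then c else 0 := by
      rw [← this]
      simp [M, Matrix.mul_apply]
    rw [h2]
    split_ifs <;> simp [hc]
  calc A.dim = (Mᵀ * (c⁻¹ • Mᵀᴴ)).rank := by rw [hM, Matrix.rank_one, QSystem.dim]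
    _ ≤ Mᵀ.rank := Matrix.rank_mul_le_left _ _
    _ ≤ r'.R.dim := Matrix.rank_le_card_width _

theorem isStandardForm_bellRealization : bellRealization.IsStandardForm := by
  refine bellRealization.isStandardForm_of_reduced (W := bellVector) (c := 1 / 2)
    bellPreparation_toMap (by norm_num) ?_ ?_
  · rintro ⟨a, -⟩ ⟨a', -⟩
    have h : ∑ i : Fin 2, bellVector (i, a, ()) () * star (bellVector (i, a', ()) ()) =
        if a = a' then 1 / 2 else 0 := by
      rw [← invSqrtTwo_mul_self]
      by_cases h : a = a' <;>
        simp [bellVector, h, apply_ite star, star_invSqrtTwo, -RCLike.star_def, eq_comm]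
    refine Eq.trans h ?_
    simp
  · change Fintype.card (Fin 2) ≤ Fintype.card (Fin 2 × Unit)
    simp

/-- The two-qubit basis vector `e₀ ⊗ e₀`. -/
def zeroVector : Matrix (Fin 2 × Fin 2) Unit ℂ :=
  Matrix.of fun x _ => if x = 0 then 1 else 0

theorem zeroVector_isometry : zeroVectorᴴ * zeroVector = 1 := by
  ext
  simp [zeroVector, Matrix.mul_apply]

/-- The pure state `e₀ ⊗ e₀`. -/
def zeroState : Channel QSystem.trivial (QSystem.qubit.prod QSystem.qubit) :=
  Channel.ofIsometry zeroVector zeroVector_isometry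

theorem isIsometry_zeroState : zeroState.IsIsometry := Channel.isIsometry_ofIsometry _ _

theorem zeroState_apply (X : Matrix Unit Unit ℂ) (p q : Fin 2 × Fin 2) :
    zeroState.toMap X p q = if p = 0 then if q = 0 then X () () else 0 else 0 := by
  rw [zeroState, Channel.ofIsometry_toMap_apply]
  split_ifs <;> simp [zeroVector, Matrix.mul_apply, *]

/-- The channel adjoining a uniform qubit to a qubit. -/
def adjoinUniform : Channel (QSystem.qubit.prod QSystem.trivial)
    (QSystem.qubit.prod QSystem.qubit) :=
  (Channel.id QSystem.qubit).tensor (uniformState QSystem.qubit)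

theorem adjoinUniform_apply (X : Matrix (Fin 2 × Unit) (Fin 2 × Unit) ℂ) (p q : Fin 2 × Fin 2) :
    adjoinUniform.toMap X p q =
      if p.2 = q.2 then 1 / 2 * X (p.1, ()) (q.1, ()) else 0 := by
  change X (p.1, ()) (q.1, ()) * ((2 : ℂ)⁻¹ * (1 : Matrix (Fin 2) (Fin 2) ℂ) p.2 q.2) = _
  rw [Matrix.one_apply]
  split_ifs <;> simp [mul_comm]

theorem sum_pauli_diag (p : Fin 2 × Fin 2) : ∑ r, pauli p r r = if p = 0 then 2 else 0 := by
  obtain ⟨a, b⟩ := p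
  fin_cases a <;> fin_cases b <;> norm_num [pauli, Prod.ext_iff]

theorem bellMeasure_adjoinUniform (X : Matrix Unit Unit ℂ) :
    bellMeasure.toMap (SuperOp.idTensor (Fin 2) adjoinUniform.toMap
      (bellPreparation.toMap X)) = zeroState.toMap X := by
  ext p q
  have h (x y : Fin 2 × Fin 2 × Fin 2) : SuperOp.idTensor (Fin 2) adjoinUniform.toMap
      (bellPreparation.toMap X) x y =
      if x.2.2 = y.2.2 then 1 / 2 * (if x.1 = x.2.1 then if y.1 = y.2.1 then 1 / 2 * X () ()
        else 0 else 0) else 0 := by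
    refine (adjoinUniform_apply _ _ _).trans ?_
    simp only [Matrix.of_apply]
    rw [bellPreparation_apply]
  have hs : 1 / 2 * ∑ b : Fin 2, ∑ r, ∑ r', ∑ a, ∑ a', pauli p r a * pauli p r' a' *
      (1 / 2 * (if r = a then if r' = a' then 1 / 2 * X () () else 0 else 0)) =
      1 / 4 * (∑ r, pauli p r r) * (∑ r, pauli p r r) * X () () := by
    simp
    ring
  rw [bellMeasure_apply, zeroState_apply]
  simp only [h, if_true]
  rw [hs, sum_pauli_diag]
  by_cases hp : p = 0 <;> by_cases hq : q = 0 <;> simp [hp, hq, eq_comm]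
  norm_num

theorem adjoinUniform_majorizesSame_zeroState : MajorizesSame adjoinUniform zeroState := by
  refine ⟨bellRealization.supermap, ⟨bellRealization, rfl, isStandardForm_bellRealization,
    isConditionallyUnital_bellMeasure⟩, ?_⟩
  ext1 X
  exact (bellMeasure_adjoinUniform X).symm

/-- Kraus operators of `pauliTwirl`. -/
def twirlKraus (i : (Fin 2 × Fin 2) × Fin 2) :
    Matrix (Fin 2 × Fin 2) (Fin 2 × Fin 2 × Fin 2) ℂ :=
  Matrix.of fun y x =>
    if x.2 = i.1 then (if y.2 = i.2 then invSqrtTwo * pauli i.1 y.1 x.1 else 0) else 0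

theorem sum_twirlKraus : ∑ i, (twirlKraus i)ᴴ * twirlKraus i = 1 := by
  ext ⟨r, j⟩ ⟨r', j'⟩
  have h : ∀ (p : Fin 2 × Fin 2) a, invSqrtTwo * pauli p a r * (invSqrtTwo * pauli p a r') =
      1 / 2 * (pauli p a r * pauli p a r') := fun p a => by
    rw [← invSqrtTwo_mul_self]; ring
  rw [Matrix.sum_apply, Fintype.sum_prod_type]
  rw [Finset.sum_comm]
  by_cases hj : j = j'
  · subst hj
    have h1 (b : Fin 2) : ∑ i, ((twirlKraus (i, b))ᴴ * twirlKraus (i, b)) (r, j) (r', j) =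
        1 / 2 * if r = r' then 1 else 0 := by
      rw [Finset.sum_eq_single j]
      · rw [← sum_pauli_mul_pauli_left j, Finset.mul_sum]
        simp [twirlKraus, Matrix.mul_apply, Fintype.sum_prod_type, apply_ite star, star_pauli,
          star_invSqrtTwo, -RCLike.star_def, h, -Fin.sum_univ_two]
      · intro i _ hi
        simp [twirlKraus, Matrix.mul_apply, Ne.symm hi]
      · simp
    simp [h1, Matrix.one_apply]
  · have hne : (r, j) ≠ (r', j') := fun h => hj (congrArg Prod.snd h)
    rw [Matrix.one_apply_ne hne]
    refine Finset.sum_eq_zero fun b _ => Finset.sum_eq_zero fun i _ => ?_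
    by_cases hi : j = i
    · have : j' ≠ i := fun h => hj (hi.trans h.symm)
      simp [twirlKraus, Matrix.mul_apply, this]
    · simp [twirlKraus, Matrix.mul_apply, hi]

/-- The channel applying a Pauli matrix to a qubit, controlled by the basis state of two qubits
that are then replaced by one uniform qubit. -/
def pauliTwirl : Channel (QSystem.qubit.prod (QSystem.qubit.prod QSystem.qubit))
    (QSystem.qubit.prod QSystem.qubit) :=
  Channel.ofKraus twirlKraus sum_twirlKraus

theorem pauliTwirl_apply (X : Matrix (Fin 2 × Fin 2 × Fin 2) (Fin 2 × Fin 2 × Fin 2) ℂ)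
    (p q : Fin 2 × Fin 2) :
    pauliTwirl.toMap X p q = if p.2 = q.2 then 1 / 2 * ∑ r, ∑ r', ∑ j,
      pauli j p.1 r * pauli j q.1 r' * X (r, j) (r', j) else 0 := by
  have h (j : Fin 2 × Fin 2) r r' (x : ℂ) :
      invSqrtTwo * pauli j p.1 r * x * (invSqrtTwo * pauli j q.1 r') =
      1 / 2 * (pauli j p.1 r * pauli j q.1 r' * x) := by
    rw [← invSqrtTwo_mul_self]; ring
  have hK (j : Fin 2 × Fin 2) (b : Fin 2) :
      (twirlKraus (j, b) * X * (twirlKraus (j, b))ᴴ) p q = if p.2 = b then if q.2 = b then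
        ∑ r', ∑ r, 1 / 2 * (pauli j p.1 r * pauli j q.1 r' * X (r, j) (r', j)) else 0 else 0 := by
    by_cases hp : p.2 = b <;> by_cases hq : q.2 = b <;>
      simp only [twirlKraus, Matrix.mul_apply, Matrix.conjTranspose_apply, Matrix.of_apply,
        apply_ite star, star_zero, star_mul', star_invSqrtTwo, star_pauli, ite_mul, mul_ite,
        zero_mul, mul_zero, Fintype.sum_prod_type (α₂ := Fin 2 × Fin 2), Finset.sum_ite_eq',
        Finset.mem_univ, if_true, if_false, ite_self, Finset.sum_const_zero, Finset.sum_mul, h,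
        hp, hq]
  rw [pauliTwirl, Channel.ofKraus_toMap_apply, Matrix.sum_apply, Fintype.sum_prod_type]
  simp only [hK, Finset.sum_ite_eq, Finset.mem_univ, if_true]
  by_cases hpq : p.2 = q.2
  · simp only [hpq, if_true, Finset.mul_sum]
    simp only [Fin.sum_univ_two, Finset.sum_add_distrib]
    ring
  · simp [hpq, Ne.symm hpq]

theorem pauliTwirl_kronecker_one (τ : Matrix (Fin 2) (Fin 2) ℂ) :
    pauliTwirl.toMap (τ ⊗ₖ (1 : Matrix (Fin 2 × Fin 2) (Fin 2 × Fin 2) ℂ)) = τ.trace • 1 := by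
  ext p q
  rw [pauliTwirl_apply, Matrix.smul_apply, Matrix.one_apply]
  simp only [Matrix.kroneckerMap_apply, Matrix.one_apply_eq, mul_one, ← Finset.sum_mul,
    sum_pauli_mul_pauli]
  by_cases h1 : p.1 = q.1 <;> by_cases h2 : p.2 = q.2 <;>
    simp [h1, h2, Prod.ext_iff, Matrix.trace]
  ring

theorem isConditionallyUnital_pauliTwirl : IsConditionallyUnital pauliTwirl := fun τ hτ => by
  have h := pauliTwirl_kronecker_one τ
  have h1 : Matrix.trace (n := Fin 2) τ = 1 := hτ.2
  rw [h1, one_smul] at h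
  convert h using 1

/-- The realization storing the input in the memory and applying `pauliTwirl`. -/
def twirlRealization : Realization QSystem.trivial (QSystem.qubit.prod QSystem.qubit)
    (QSystem.qubit.prod QSystem.trivial) where
  R := QSystem.qubit
  pre := Channel.id (QSystem.qubit.prod QSystem.trivial)
  pre_isometry := Channel.isIsometry_id _
  post := pauliTwirl

theorem isStandardForm_twirlRealization : twirlRealization.IsStandardForm := by
  intro r' _
  have h := r'.pre_isometry.dim_le
  have hd (R : QSystem) : (R.prod QSystem.trivial).dim = R.dim := by simp [QSystem.dim]
  rwa [hd, hd] at h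

theorem pauliTwirl_zeroState (X : Matrix (Fin 2 × Unit) (Fin 2 × Unit) ℂ) :
    pauliTwirl.toMap (SuperOp.idTensor (Fin 2) zeroState.toMap X) = adjoinUniform.toMap X := by
  ext p q
  have h (x y : Fin 2 × Fin 2 × Fin 2) : SuperOp.idTensor (Fin 2) zeroState.toMap X x y =
      if x.2 = 0 then if y.2 = 0 then X (x.1, ()) (y.1, ()) else 0 else 0 :=
    zeroState_apply _ _ _
  have h0 (a r : Fin 2) : pauli 0 a r = if a = r then 1 else 0 := by simp [pauli]
  rw [pauliTwirl_apply, adjoinUniform_apply]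
  have (r r' : Fin 2) : ∑ j, pauli j p.1 r * pauli j q.1 r' *
      (if j = 0 then if j = 0 then X (r, ()) (r', ()) else 0 else 0) =
      pauli 0 p.1 r * pauli 0 q.1 r' * X (r, ()) (r', ()) := by
    rw [Finset.sum_eq_single 0] <;> simp +contextual
  simp only [h, this]
  simp only [h0, ite_mul, mul_ite, one_mul, zero_mul, mul_one, mul_zero,
    Finset.sum_ite_eq, Finset.mem_univ, if_true]

theorem zeroState_majorizesSame_adjoinUniform : MajorizesSame zeroState adjoinUniform := by
  refine ⟨twirlRealization.supermap, ⟨twirlRealization, rfl, isStandardForm_twirlRealization,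
    isConditionallyUnital_pauliTwirl⟩, ?_⟩
  ext1 X
  exact (pauliTwirl_zeroState X).symm

namespace IsChannelEntropy

variable {H : (A B : QSystem) → Channel A B → ℝ}

theorem isometry_eq_id (hH : IsChannelEntropy H) {A B : QSystem} {V : Channel A B}
    (hV : V.IsIsometry) : H A B V = H A A (Channel.id A) :=
  le_antisymm (hH.monotone _ _ _ _ _ _ hV.majorizes_id) (hH.monotone _ _ _ _ _ _ hV.id_majorizes)

theorem id_antitone (hH : IsChannelEntropy H) {A B : QSystem} (h : A.dim ≤ B.dim) :
    H B B (Channel.id B) ≤ H A A (Channel.id A) := by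
  obtain ⟨V, hV⟩ := exists_isIsometry h
  rw [← hH.isometry_eq_id hV]
  exact hH.monotone _ _ _ _ _ _ (MajorizesSame.of_comp (Channel.id B) V hV).majorizes

theorem id_prod (hH : IsChannelEntropy H) (A B : QSystem) :
    H _ _ (Channel.id (A.prod B)) = H A A (Channel.id A) + H B B (Channel.id B) := by
  rw [← hH.additive, Channel.id_tensor_id]

theorem id_congr (hH : IsChannelEntropy H) {A B : QSystem} (h : A.dim = B.dim) :
    H A A (Channel.id A) = H B B (Channel.id B) :=
  le_antisymm (hH.id_antitone h.ge) (hH.id_antitone h.le)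

theorem id_trivial (hH : IsChannelEntropy H) : H _ _ (Channel.id QSystem.trivial) = 0 := by
  have h := hH.id_prod QSystem.trivial QSystem.trivial
  rw [hH.id_congr (A := QSystem.trivial.prod QSystem.trivial) (B := QSystem.trivial) rfl] at h
  linarith

theorem id_qubit (hH : IsChannelEntropy H) : H _ _ (Channel.id QSystem.qubit) = -1 := by
  have h1 := hH.monotone _ _ _ _ _ _ adjoinUniform_majorizesSame_zeroState.majorizes
  have h2 := hH.monotone _ _ _ _ _ _ zeroState_majorizesSame_adjoinUniform.majorizes
  have h3 : H _ _ zeroState = 0 := by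
    rw [hH.isometry_eq_id isIsometry_zeroState, hH.id_trivial]
  have h4 : H _ _ adjoinUniform = H _ _ (Channel.id QSystem.qubit) + 1 := by
    rw [adjoinUniform, hH.additive, hH.normalized]
  linarith

theorem id_eq (hH : IsChannelEntropy H) (A : QSystem) :
    H A A (Channel.id A) = -Real.logb 2 A.dim := by
  let S : ℕ → QSystem := fun n => ⟨Fin (n - 1 + 1)⟩
  have hS : ∀ n, 0 < n → (S n).dim = n := fun n hn =>
    (Fintype.card_fin _).trans (Nat.sub_add_cancel hn)
  have hA : 0 < A.dim := Fintype.card_pos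
  have key := eq_logb_of_monotone_of_additive (f := fun n => -H _ _ (Channel.id (S n)))
    (fun m n hm hmn => neg_le_neg (hH.id_antitone (by rwa [hS m hm, hS n (hm.trans_le hmn)])))
    (fun m n hm hn => by
      have h : (S (m * n)).dim = ((S m).prod (S n)).dim := by
        rw [hS _ (Nat.mul_pos hm hn)]
        exact ((Fintype.card_prod _ _).trans (congrArg₂ _ (hS m hm) (hS n hn))).symm
      simp only [hH.id_congr h, hH.id_prod]
      ring)
    (by
      rw [hH.id_congr (A := S 2) (B := QSystem.qubit) rfl, hH.id_qubit, neg_neg]) hA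
  rw [hH.id_congr (B := S A.dim) (hS _ hA).symm, ← key, neg_neg]

end IsChannelEntropy

end

theorem theorem17 (H : (A B : QSystem) → Channel A B → ℝ) (hH : IsChannelEntropy H) :
    (∀ (A B : QSystem) (V : Channel A B), V.IsIsometry →
      H A B V = -Real.logb 2 (A.dim : ℝ)) ∧
    ∃ (A B : QSystem) (N : Channel A B), H A B N < 0 := by
  refine ⟨fun A B V hV => (hH.isometry_eq_id hV).trans (hH.id_eq A), ?_⟩
  exact ⟨_, _, Channel.id QSystem.qubit, by rw [hH.id_qubit]; norm_num⟩
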